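/- Let $N$ be a finite set of $n\ge 5$ voters and $A$ a finite set of $m\ge 4$ alternatives. A preference profile $R=(\succ_i)_{i\in N}$ assigns to every voter $i$ a strict linear order $\succ_i$ on $A$. A social decision scheme (SDS) $f$ maps every preference profile $R$ to a probability distribution on $A$; $f(R,x)$ denotes the probability of $x\in A$. Put $n_{xy}(R)=|\{i\in N: x\succ_i y\}|$. The SDS $f$ is - strategyproof if $\sum_{y\succ_i x} f(R,y)\ge \sum_{y\succ_i x} f(R',y)$ for all $x\in A$, all $i\in N$ and all profiles $R,R'$ that differ at most in the preferences of voter $i$, where $\succ_i$ is the preference of $i$ in $R$; - anonymous if $f(\pi(R))=f(R)$ for all $R$ and all permutations $\pi$ of $N$, and neutral if $f(\tau(R),\tau(x))=f(R,x)$ for all $R$, all $x\in A$ and all permutations $\tau$ of $A$; - $\alpha$-Condorcet-consistent if $f(R,x)\ge\alpha$ whenever $x$ is a Condorcet winner in $R$, that is, $n_{xy}(R)>n_{yx}(R)$ for all $y\ne x$; - $\beta$-ex post efficient if $f(R,x)\le\beta$ whenever $x$ is Pareto-dominated in $R$, that is, there is $y\in A$ with $y\succ_i x$ for all $i\in N$.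 The uniform random dictatorship $f_{RD}$ is $f_{RD}(R,x)=\frac1n|\{i\in N: x \text{ is the best alternative of } \succ_i\}|$. The randomized Copeland rule $f_C$ is $f_C(R,x)=c(x,R)/\sum_{y\in A}c(y,R)$, where $c(x,R)=|\{y\ne x: n_{xy}(R)>n_{yx}(R)\}|+\frac12|\{y\ne x: n_{xy}(R)=n_{yx}(R)\}|$. Theorem. Let $m\ge 4$, $n\ge 5$ and let $\alpha,\beta$ be real numbers. (1) If $\beta<\frac{m-2}{m-1}\,\alpha$, then no strategyproof SDS is both $\alpha$-Condorcet-consistent and $\beta$-ex post efficient. (2) If $\beta=\frac{m-2}{m-1}\,\alpha$, then every anonymous, neutral and strategyproof SDS $f$ that is $\alpha$-Condorcet-consistent and $\beta$-ex post efficient is a mixture of the uniform random dictatorship and the randomized Copeland rule: $f=\lambda f_{RD}+(1-\lambda)f_C$ for some $\lambda\in[0,1]$. -/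

import Mathlib

namespace SocialChoice

/-- A preference relation on `A`, given by its strict part: `P.prefers x y` means `x ≻ y`. -/
@[ext]
structure Pref (A : Type*) where
  prefers : A → A → Prop
  irrefl : ∀ x, ¬ prefers x x
  trans : ∀ x y z, prefers x y → prefers y z → prefers x z
  complete : ∀ x y, x ≠ y → prefers x y ∨ prefers y x

/-- A preference profile: one preference relation for every voter. -/
abbrev Profile (N A : Type*) := N → Pref A

/-- Lotteries over `A`: nonnegative functions `A → ℝ` that sum to `1`. -/
abbrev Lottery (A : Type*) [Fintype A] := stdSimplex ℝ A

/-- Social decision schemes; `(f R).1 x` is the probability `f(R, x)`. -/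
abbrev SDS (N A : Type*) [Fintype A] := Profile N A → Lottery A

/-- The profile `π(R)`: voter `π i` has in `π(R)` the preference of voter `i` in `R`. -/
def permuteVoters {N A : Type*} (π : Equiv.Perm N) (R : Profile N A) : Profile N A :=
  fun j => R (π.symm j)

/-- The relation `τ(P)`: it ranks `τ x` above `τ y` if and only if `P` ranks `x` above `y`. -/
def Pref.permute {A : Type*} (τ : Equiv.Perm A) (P : Pref A) : Pref A where
  prefers x y := P.prefers (τ.symm x) (τ.symm y)
  irrefl _ := P.irrefl _
  trans _ _ _ := P.trans _ _ _
  complete _ _ h := P.complete _ _ fun e => h (τ.symm.injective e)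

/-- The profile `τ(R)` obtained by permuting the alternatives according to `τ`. -/
def permuteAlternatives {N A : Type*} (τ : Equiv.Perm A) (R : Profile N A) : Profile N A :=
  fun i => (R i).permute τ

section

variable {N A : Type*} [Fintype A]

/-- `f(π(R)) = f(R)` for all permutations `π` of the voters. -/
def Anonymous (f : SDS N A) : Prop :=
  ∀ (R : Profile N A) (π : Equiv.Perm N), f R = f (permuteVoters π R)

/-- `f(R, x) = f(τ(R), τ(x))` for all permutations `τ` of the alternatives. -/
def Neutral (f : SDS N A) : Prop :=
  ∀ (R : Profile N A) (τ : Equiv.Perm A) (x : A),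
    (f R).1 x = (f (permuteAlternatives τ R)).1 (τ x)

open Classical in
/-- Weak preference between lotteries by stochastic dominance: for every `x`, the lottery `p`
gives the alternatives strictly better than `x` at least as much probability as `q`. -/
def StochDominates (P : Pref A) (p q : Lottery A) : Prop :=
  ∀ x : A, ∑ y with P.prefers y x, q.1 y ≤ ∑ y with P.prefers y x, p.1 y

/-- No voter can gain, in the sense of stochastic dominance, by misreporting. -/
def Strategyproof (f : SDS N A) : Prop :=
  ∀ (R R' : Profile N A) (i : N), (∀ j, j ≠ i → R j = R' j) →
    StochDominates (R i) (f R) (f R')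

/-- `x` Pareto-dominates `y` in `R`. -/
def ParetoDominates (R : Profile N A) (x y : A) : Prop :=
  ∀ i, (R i).prefers x y

/-- Pareto-dominated alternatives have probability at most `β`. -/
def ExPostEfficient (β : ℝ) (f : SDS N A) : Prop :=
  ∀ (R : Profile N A) (x : A), (∃ y, ParetoDominates R y x) → (f R).1 x ≤ β

/-- The convex combination `l f + (1 - l) g`. -/
noncomputable def mixture (l : Set.Icc (0 : ℝ) 1) (f g : SDS N A) : SDS N A := fun R =>
  ⟨fun x => (l : ℝ) * (f R).1 x + (1 - (l : ℝ)) * (g R).1 x, by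
    constructor
    · intro x
      exact add_nonneg (mul_nonneg l.2.1 ((f R).2.1 x))
        (mul_nonneg (sub_nonneg.2 l.2.2) ((g R).2.1 x))
    · rw [Finset.sum_add_distrib, ← Finset.mul_sum, ← Finset.mul_sum, (f R).2.2, (g R).2.2]
      ring⟩

variable [Fintype N]

open Classical in
/-- The supporting size `n_{xy}(R)`: the number of voters who prefer `x` to `y`. -/
noncomputable def supportingSize (R : Profile N A) (x y : A) : ℕ :=
  Finset.card {i : N | (R i).prefers x y}

/-- `x` wins the majority comparison against every other alternative. -/
def CondorcetWinner (R : Profile N A) (x : A) : Prop :=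
  ∀ y, y ≠ x → supportingSize R y x < supportingSize R x y

/-- A Condorcet winner always has probability at least `α`. -/
def CondorcetConsistent (α : ℝ) (f : SDS N A) : Prop :=
  ∀ (R : Profile N A) (x : A), CondorcetWinner R x → α ≤ (f R).1 x

/-- `x` is the best alternative according to `P`. -/
def Pref.IsTop (P : Pref A) (x : A) : Prop := ∀ y, y ≠ x → P.prefers x y

theorem Pref.existsUnique_isTop [Nonempty A] (P : Pref A) : ∃! x, P.IsTop x := by
  have h : ∃ x, ∀ y, ¬ P.prefers y x := by
    have : IsTrans A P.prefers := ⟨P.trans⟩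
    have : Std.Irrefl P.prefers := ⟨P.irrefl⟩
    have wf : WellFounded P.prefers := Finite.wellFounded_of_trans_of_irrefl _
    obtain ⟨x, -, hx⟩ := wf.has_min Set.univ Set.univ_nonempty
    exact ⟨x, fun y => hx y (Set.mem_univ y)⟩
  obtain ⟨x, hx⟩ := h
  refine ⟨x, fun y hy => (P.complete x y hy.symm).resolve_right (hx y), fun z hz => ?_⟩
  by_contra hne
  exact hx z (hz x (Ne.symm hne))

open Classical in
/-- The uniform random dictatorship: draw a voter uniformly at random and return his best
alternative, so that `x` has probability `|{i : x is top-ranked by i}| / n`. -/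
noncomputable def uniformRandomDictatorship (N A : Type*) [Fintype N] [Fintype A]
    [Nonempty N] [Nonempty A] : SDS N A := fun R =>
  ⟨fun x => (Finset.card {i : N | (R i).IsTop x} : ℝ) / Fintype.card N, by
    constructor
    · intro x
      positivity
    · have h : ∀ i : N, ∑ x : A, (if (R i).IsTop x then (1 : ℝ) else 0) = 1 := by
        intro i
        obtain ⟨t, ht, hu⟩ := (R i).existsUnique_isTop
        rw [Finset.sum_eq_single t, if_pos ht]
        · intro b _ hb
          exact if_neg fun hb' => hb (hu b hb')
        · intro hn
          exact absurd (Finset.mem_univ t) hn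
      rw [← Finset.sum_div]
      simp only [Finset.card_filter, Nat.cast_sum, Nat.cast_ite, Nat.cast_one, Nat.cast_zero]
      rw [Finset.sum_comm]
      simp [h]⟩

open Classical in
/-- The Copeland score `c(x, R)`: majority wins of `x`, plus one half for every majority tie. -/
noncomputable def copelandScore (R : Profile N A) (x : A) : ℝ :=
  (Finset.card {y : A | y ≠ x ∧ supportingSize R y x < supportingSize R x y} : ℝ) +
    1 / 2 * (Finset.card {y : A | y ≠ x ∧ supportingSize R x y = supportingSize R y x} : ℝ)

theorem copelandScore_nonneg (R : Profile N A) (x : A) : 0 ≤ copelandScore R x := by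
  unfold copelandScore
  positivity

theorem copelandScore_pos (R : Profile N A) {x y : A} (hxy : y ≠ x)
    (h : supportingSize R y x ≤ supportingSize R x y) : 0 < copelandScore R x := by
  classical
  unfold copelandScore
  rcases h.lt_or_eq with h | h
  · have : 0 < Finset.card {y : A | y ≠ x ∧ supportingSize R y x < supportingSize R x y} :=
      Finset.card_pos.2 ⟨y, by simp [hxy, h]⟩
    positivity
  · have : 0 < Finset.card {y : A | y ≠ x ∧ supportingSize R x y = supportingSize R y x} :=
      Finset.card_pos.2 ⟨y, by simp [hxy, h]⟩
    positivity

theorem sum_copelandScore_pos [Nontrivial A] (R : Profile N A) :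
    0 < ∑ x, copelandScore R x := by
  obtain ⟨x, y, hxy⟩ := exists_pair_ne A
  rcases le_total (supportingSize R y x) (supportingSize R x y) with h | h
  · exact Finset.sum_pos' (fun z _ => copelandScore_nonneg R z)
      ⟨x, Finset.mem_univ x, copelandScore_pos R hxy.symm h⟩
  · exact Finset.sum_pos' (fun z _ => copelandScore_nonneg R z)
      ⟨y, Finset.mem_univ y, copelandScore_pos R hxy h⟩

/-- The randomized Copeland rule: probabilities proportional to the Copeland scores. -/
noncomputable def randomizedCopeland (N A : Type*) [Fintype N] [Fintype A] [Nontrivial A] :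
    SDS N A := fun R =>
  ⟨fun x => copelandScore R x / ∑ y, copelandScore R y, by
    constructor
    · intro x
      exact div_nonneg (copelandScore_nonneg R x) (sum_copelandScore_pos R).le
    · rw [← Finset.sum_div]
      exact div_self (sum_copelandScore_pos R).ne'⟩

end

end SocialChoice

/-! Write m, n for the numbers of alternatives and voters. Strategyproofness makes the probability
of `x` depend only on the sets ranked above `x` (`Strategyproof.apply_eq_of_upper_eq`). When one
voter lifts `y` just above `x`, the loss of `x` is the gain of `y`, and the other voters affect it
only through their comparison of `x` and `y`. Under anonymity and neutrality this loss is a function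
d(k, s) of the number k of alternatives that the voter ranks above `x` and the number s of voters
already preferring `y`. Letting two voters lift `y` in either order gives d(k, s) = a(k) + b(s), and
summing the losses yields (`exists_apply_eq`) f(R, x) = c - ∑ i, p(number of alternatives i ranks
above x) - ∑ y, q(n_yx), with p, q monotone and vanishing at 0.

Three kinds of profile now suffice. With h = ⌊(n-1)/2⌋, they give n p(m-1) + (m-1) q(n) ≤ c, c - n
p(1) - q(n) ≤ β and α ≤ c - n p(1) - q(h). Hence (m-1)β - (m-2)α ≥ n (p(m-1) - p(1)) + (m-2) q(h) ≥
0. This is the bound; averaging over all relabellings (`SDS.symmetrize`) removes anonymity and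
neutrality from it. Equality forces p(m-1) = p(1), q(h) = 0 and equality in the first estimate. Then
p only detects whether `x` is top-ranked, and q, by q(j) + q(n-j) = q(n), only detects who wins the
majority comparison, so f is the claimed mixture (`exists_eq_mixture`). -/

namespace SocialChoice

/-! ### Upper contour sets -/

open Classical in
/-- The alternatives strictly better than `x`. -/
noncomputable def Pref.upper {A : Type*} [Fintype A] (P : Pref A) (x : A) : Finset A :=
  {y | P.prefers y x}

/-- Rank the alternatives by the levels `l`, ties broken by a fixed enumeration. -/
noncomputable def Pref.ofLevel {A : Type*} [Fintype A] (l : A → ℕ) : Pref A where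
  prefers a b := l a < l b ∨ (l a = l b ∧ Fintype.equivFin A a < Fintype.equivFin A b)
  irrefl _ h := by simp at h
  trans a b c h₁ h₂ := by
    rcases h₁ with h₁ | ⟨h₁, h₁'⟩ <;> rcases h₂ with h₂ | ⟨h₂, h₂'⟩
    · exact .inl (h₁.trans h₂)
    · exact .inl (h₂ ▸ h₁)
    · exact .inl (h₁ ▸ h₂)
    · exact .inr ⟨h₁.trans h₂, h₁'.trans h₂'⟩
  complete a b h := by
    rcases lt_trichotomy (l a) (l b) with h' | h' | h'
    · exact .inl (.inl h')
    · rcases lt_or_gt_of_ne ((Fintype.equivFin A).injective.ne h) with h'' | h''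
      · exact .inl (.inr ⟨h', h''⟩)
      · exact .inr (.inr ⟨h'.symm, h''⟩)
    · exact .inr (.inl h')

section

open Classical

variable {N A : Type*} [Fintype A]

@[simp]
theorem Pref.mem_upper {P : Pref A} {x y : A} : y ∈ P.upper x ↔ P.prefers y x := by
  simp [Pref.upper]

theorem Pref.notMem_upper_self (P : Pref A) (x : A) : x ∉ P.upper x := by
  simpa using P.irrefl x

/-- An up-set which does not contain everything is a strict upper contour set. -/
theorem Pref.exists_upper_eq (P : Pref A) (U : Finset A)
    (hU : ∀ a ∈ U, ∀ b, P.prefers b a → b ∈ U) (h : U ≠ Finset.univ) :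
    ∃ z, P.upper z = U := by
  have : IsTrans A P.prefers := ⟨P.trans⟩
  have : Std.Irrefl P.prefers := ⟨P.irrefl⟩
  have wf : WellFounded P.prefers := Finite.wellFounded_of_trans_of_irrefl _
  obtain ⟨w, hw⟩ : ∃ w, w ∉ U := by
    by_contra! h'
    exact h (Finset.eq_univ_iff_forall.2 h')
  -- `z` is the most preferred alternative outside `U`.
  obtain ⟨z, hz, hz'⟩ := wf.has_min {a | a ∉ U} ⟨w, hw⟩
  refine ⟨z, Finset.ext fun a => ?_⟩
  rw [Pref.mem_upper]
  refine ⟨fun ha => by_contra fun h' => hz' a h' ha, fun ha => ?_⟩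
  refine (P.complete a z ?_).resolve_right fun h' => hz (hU a ha z h')
  rintro rfl
  exact hz ha

/-! ### Local consequences of strategyproofness -/

theorem Strategyproof.sum_le_sum {f : SDS N A} (hf : Strategyproof f) {R R' : Profile N A}
    {i : N} (h : ∀ j, j ≠ i → R j = R' j) (U : Finset A)
    (hU : ∀ a ∈ U, ∀ b, (R i).prefers b a → b ∈ U) :
    ∑ a ∈ U, (f R').1 a ≤ ∑ a ∈ U, (f R).1 a := by
  by_cases hu : U = Finset.univ
  · rw [hu, (f R).2.2, (f R').2.2]
  · obtain ⟨z, hz⟩ := (R i).exists_upper_eq U hU hu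
    have := hf R R' i h z
    rw [← hz]
    exact this

/-- Each profile is a manipulation of the other, so the inequality holds in both directions. -/
theorem Strategyproof.sum_eq_sum {f : SDS N A} (hf : Strategyproof f) {R R' : Profile N A}
    {i : N} (h : ∀ j, j ≠ i → R j = R' j) (U : Finset A)
    (hU : ∀ a ∈ U, ∀ b, (R i).prefers b a → b ∈ U)
    (hU' : ∀ a ∈ U, ∀ b, (R' i).prefers b a → b ∈ U) :
    ∑ a ∈ U, (f R).1 a = ∑ a ∈ U, (f R').1 a :=
  le_antisymm (hf.sum_le_sum (fun j hj => (h j hj).symm) U hU') (hf.sum_le_sum h U hU)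

theorem Pref.upper_isUpper (P : Pref A) (x : A) :
    ∀ a ∈ P.upper x, ∀ b, P.prefers b a → b ∈ P.upper x := by
  intro a ha b hb
  rw [Pref.mem_upper] at *
  exact P.trans _ _ _ hb ha

theorem Pref.insert_upper_isUpper (P : Pref A) (x : A) :
    ∀ a ∈ insert x (P.upper x), ∀ b, P.prefers b a → b ∈ insert x (P.upper x) := by
  intro a ha b hb
  rw [Finset.mem_insert] at *
  rcases ha with rfl | ha
  · exact .inr (Pref.mem_upper.2 hb)
  · exact .inr (P.upper_isUpper x a ha b hb)

/-- The set above `x`, with or without `x` added, is an up-set for both preferences; subtracting the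
two preserved sums isolates `x`. -/
theorem Strategyproof.apply_eq_of_upper_eq_of_forall_ne {f : SDS N A} (hf : Strategyproof f)
    {R R' : Profile N A} {i : N} (h : ∀ j, j ≠ i → R j = R' j) {x : A}
    (hx : (R i).upper x = (R' i).upper x) : (f R).1 x = (f R').1 x := by
  have h₁ := hf.sum_eq_sum h ((R i).upper x) ((R i).upper_isUpper x)
    (by rw [hx]; exact (R' i).upper_isUpper x)
  have h₂ := hf.sum_eq_sum h (insert x ((R i).upper x)) ((R i).insert_upper_isUpper x)
    (by rw [hx]; exact (R' i).insert_upper_isUpper x)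
  rw [Finset.sum_insert ((R i).notMem_upper_self x),
    Finset.sum_insert ((R i).notMem_upper_self x)] at h₂
  linarith

/-- The probability of `x` depends only on the sets of alternatives ranked above `x`. -/
theorem Strategyproof.apply_eq_of_upper_eq [Fintype N] {f : SDS N A} (hf : Strategyproof f)
    {R R' : Profile N A} {x : A} (hx : ∀ i, (R i).upper x = (R' i).upper x) :
    (f R).1 x = (f R').1 x := by
  -- Voters switch from `R` to `R'` one at a time; `s` holds those who have switched.
  have key : ∀ s : Finset N, (f R).1 x = (f (fun j => if j ∈ s then R' j else R j)).1 x := by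
    intro s
    induction s using Finset.induction_on with
    | empty => simp
    | insert i s hi ih =>
      rw [ih]
      refine hf.apply_eq_of_upper_eq_of_forall_ne (i := i) (fun j hj => ?_) ?_
      · simp [Finset.mem_insert, hj]
      · simp [hi, hx i]
  simpa using key Finset.univ

/-- The two lotteries differ only on `x` and `y` if a voter swaps these adjacent alternatives,
and the lowered alternative does not gain. -/
theorem Strategyproof.swap {f : SDS N A} (hf : Strategyproof f) {R R' : Profile N A} {i : N}
    (h : ∀ j, j ≠ i → R j = R' j) {x y : A} (hxy : x ≠ y) (V : Finset A) (hxV : x ∉ V)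
    (hyV : y ∉ V) (hx : (R i).upper x = V) (hy : (R i).upper y = insert x V)
    (hx' : (R' i).upper x = insert y V) (hy' : (R' i).upper y = V) :
    (f R).1 x + (f R).1 y = (f R').1 x + (f R').1 y ∧ (f R').1 x ≤ (f R).1 x := by
  have h₁ := hf.sum_eq_sum h V (by rw [← hx]; exact (R i).upper_isUpper x)
    (by rw [← hy']; exact (R' i).upper_isUpper y)
  have h₂ := hf.sum_eq_sum h (insert y (insert x V))
    (by rw [← hy]; exact (R i).insert_upper_isUpper y)
    (by rw [Finset.insert_comm, ← hx']; exact (R' i).insert_upper_isUpper x)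
  have h₃ := hf.sum_le_sum h (insert x V)
    (by rw [← hy]; exact (R i).upper_isUpper y)
  rw [Finset.sum_insert (by simp [hyV, hxy.symm]), Finset.sum_insert hxV,
    Finset.sum_insert (by simp [hyV, hxy.symm]), Finset.sum_insert hxV] at h₂
  rw [Finset.sum_insert hxV, Finset.sum_insert hxV] at h₃
  constructor <;> linarith

/-! ### Losses as functions of upper contour sets -/

/-- Rank the alternatives in `V` first and `x` next. -/
noncomputable def Pref.ofUpper (x : A) (V : Finset A) : Pref A :=
  Pref.ofLevel fun a => if a ∈ V then 0 else if a = x then 1 else 2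

theorem Pref.upper_ofUpper {x : A} {V : Finset A} (h : x ∉ V) :
    (Pref.ofUpper x V).upper x = V := by
  ext a
  rw [Pref.mem_upper]
  simp only [Pref.ofUpper, Pref.ofLevel]
  by_cases ha : a ∈ V <;> by_cases hax : a = x <;> simp_all

/-- The probability of `x` if `V i` is the set of alternatives that voter `i` ranks above `x`. -/
noncomputable def upperValue (f : SDS N A) (x : A) (V : N → Finset A) : ℝ :=
  (f fun i => Pref.ofUpper x (V i)).1 x

theorem Strategyproof.apply_eq_upperValue [Fintype N] {f : SDS N A} (hf : Strategyproof f)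
    {R : Profile N A} {x : A} {V : N → Finset A} (h : ∀ i, (R i).upper x = V i) :
    (f R).1 x = upperValue f x V := by
  refine hf.apply_eq_of_upper_eq fun i => ?_
  rw [h, Pref.upper_ofUpper]
  rw [← h]
  exact (R i).notMem_upper_self x

theorem exists_adjacent {x y : A} (hxy : x ≠ y) {V : Finset A} (hx : x ∉ V) (hy : y ∉ V) :
    ∃ P : Pref A, P.upper x = V ∧ P.upper y = insert x V := by
  refine ⟨Pref.ofLevel fun a => if a ∈ V then 0 else if a = x then 1 else if a = y then 2 else 3,
    ?_, ?_⟩ <;> ext a <;> rw [Pref.mem_upper] <;> simp only [Pref.ofLevel] <;>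
    by_cases ha : a ∈ V <;> by_cases hax : a = x <;> by_cases hay : a = y <;> simp_all [hxy.symm]

/-- Pushing `y` to the very top or the very bottom leaves the set above `x` intact, while the set
above `y` then records only the comparison of `x` and `y`. -/
theorem exists_upper_pair {x y : A} (hxy : x ≠ y) {V : Finset A} (hx : x ∉ V) :
    ∃ P : Pref A, P.upper x = V ∧ P.upper y = if y ∈ V then ∅ else Finset.univ.erase y := by
  by_cases hyV : y ∈ V
  · refine ⟨Pref.ofLevel fun a => if a = y then 0 else if a ∈ V then 1 else if a = x then 2 else 3,
      ?_, ?_⟩ <;> ext a <;> rw [Pref.mem_upper] <;> simp only [Pref.ofLevel] <;>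
      by_cases ha : a ∈ V <;> by_cases hax : a = x <;> by_cases hay : a = y <;> simp_all
  · refine ⟨Pref.ofLevel fun a => if a ∈ V then 0 else if a = x then 1 else if a = y then 3 else 2,
      ?_, ?_⟩ <;> ext a <;> rw [Pref.mem_upper] <;> simp only [Pref.ofLevel] <;>
      by_cases ha : a ∈ V <;> by_cases hax : a = x <;> by_cases hay : a = y <;> simp_all [hxy.symm]

/-- The loss of `x` when voter `i` moves `y` above `x`. -/
noncomputable def drop (f : SDS N A) (x y : A) (i : N) (V : N → Finset A) : ℝ :=
  upperValue f x V - upperValue f x (Function.update V i (insert y (V i)))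

/-- What `x` loses is what `y` gains, and the other voters matter for this only through their
comparison of `x` and `y`. -/
theorem Strategyproof.drop_eq_sub [Fintype N] {f : SDS N A} (hf : Strategyproof f) {x y : A}
    (hxy : x ≠ y) (i : N) (V : N → Finset A) (hx : ∀ j, x ∉ V j) (hy : y ∉ V i) :
    0 ≤ drop f x y i V ∧ drop f x y i V =
      upperValue f y (fun j => if j = i then V i else if y ∈ V j then ∅ else Finset.univ.erase y) -
      upperValue f y (fun j => if j = i then insert x (V i) else
        if y ∈ V j then ∅ else Finset.univ.erase y) := by
  obtain ⟨P, hP, hP'⟩ := exists_adjacent hxy (hx i) hy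
  obtain ⟨P', hP₁, hP₁'⟩ := exists_adjacent hxy.symm hy (hx i)
  choose Q hQ hQ' using fun j => exists_upper_pair hxy (hx j)
  -- In `Q` every voter has `y` at an extreme. Seen from `x` this is still `V`; seen from `y` it no
  -- longer remembers the rest of `V j` for `j ≠ i`.
  have key := hf.swap (R := Function.update Q i P) (R' := Function.update Q i P') (i := i)
    (fun j hj => by simp [hj]) hxy (V i) (hx i) hy (by simpa using hP) (by simpa using hP')
    (by simpa using hP₁') (by simpa using hP₁)
  rw [hf.apply_eq_upperValue (R := Function.update Q i P) (x := x) (V := V),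
    hf.apply_eq_upperValue (R := Function.update Q i P') (x := x)
      (V := Function.update V i (insert y (V i))),
    hf.apply_eq_upperValue (R := Function.update Q i P) (x := y)
      (V := fun j => if j = i then insert x (V i) else
        if y ∈ V j then ∅ else Finset.univ.erase y),
    hf.apply_eq_upperValue (R := Function.update Q i P') (x := y)
      (V := fun j => if j = i then V i else if y ∈ V j then ∅ else Finset.univ.erase y)] at key
  · unfold drop
    constructor <;> linarith [key.1, key.2]
  all_goals
    intro j
    by_cases hj : j = i
    · subst hj
      simp [hP, hP', hP₁, hP₁']
    · simp [hj, hQ, hQ']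

theorem Strategyproof.drop_congr [Fintype N] {f : SDS N A} (hf : Strategyproof f) {x y : A}
    (hxy : x ≠ y) (i : N) (V V' : N → Finset A) (hx : ∀ j, x ∉ V j) (hx' : ∀ j, x ∉ V' j)
    (hy : y ∉ V i) (hi : V i = V' i) (h : ∀ j, y ∈ V j ↔ y ∈ V' j) :
    drop f x y i V = drop f x y i V' := by
  rw [(hf.drop_eq_sub hxy i V hx hy).2, (hf.drop_eq_sub hxy i V' hx' (hi ▸ hy)).2]
  simp only [hi, h]

/-! ### Relabelling voters and alternatives -/

theorem Pref.upper_permute (τ : Equiv.Perm A) (P : Pref A) (x : A) :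
    (P.permute τ).upper (τ x) = (P.upper x).map τ.toEmbedding := by
  ext a
  rw [Finset.mem_map_equiv, Pref.mem_upper, Pref.mem_upper]
  simp [Pref.permute]

theorem Neutral.upperValue_map [Fintype N] {f : SDS N A} (hn : Neutral f) (hf : Strategyproof f)
    (τ : Equiv.Perm A) (x : A) (V : N → Finset A) (hx : ∀ j, x ∉ V j) :
    upperValue f (τ x) (fun j => (V j).map τ.toEmbedding) = upperValue f x V := by
  conv_rhs => rw [upperValue, hn _ τ]
  refine (hf.apply_eq_upperValue fun i => ?_).symm
  rw [permuteAlternatives, Pref.upper_permute, Pref.upper_ofUpper (hx i)]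

theorem Anonymous.upperValue_comp {f : SDS N A} (ha : Anonymous f)
    (π : Equiv.Perm N) (x : A) (V : N → Finset A) :
    upperValue f x (fun j => V (π.symm j)) = upperValue f x V := by
  rw [upperValue, upperValue, ha (fun i => Pref.ofUpper x (V i)) π]
  rfl

end

section

open Classical

variable {N A : Type*}

theorem exists_perm_mem_iff [Fintype A] {s t : Finset A} (h : s.card = t.card) :
    ∃ τ : Equiv.Perm A, ∀ a, τ a ∈ t ↔ a ∈ s := by
  let e : {a // a ∈ s} ≃ {a // a ∈ t} := Finset.equivOfCardEq h
  refine ⟨e.extendSubtype, fun a => ⟨fun ha => by_contra fun h' => ?_, fun ha => ?_⟩⟩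
  · exact e.extendSubtype_not_mem a h' ha
  · exact e.extendSubtype_mem a ha

/-- `τ x` and `x'` both lie outside `t`, so transposing them does not disturb membership in `t`. -/
theorem exists_perm_mem_iff_of_apply_eq {t s : Finset A} {τ : Equiv.Perm A}
    (hτ : ∀ a, τ a ∈ t ↔ a ∈ s) {x x' : A} (hx : x ∉ s) (hx' : x' ∉ t) :
    ∀ a, (τ.trans (Equiv.swap (τ x) x')) a ∈ t ↔ a ∈ s := by
  intro a
  rw [← hτ a, Equiv.trans_apply]
  have hx₁ : τ x ∉ t := by rwa [hτ]
  by_cases h₁ : τ a = τ x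
  · rw [h₁, Equiv.swap_apply_left]
    simp [hx', hx₁]
  by_cases h₂ : τ a = x'
  · rw [h₂, Equiv.swap_apply_right]
    simp [hx', hx₁]
  rw [Equiv.swap_apply_of_ne_of_ne h₁ h₂]

theorem exists_perm_mem_iff_apply [Fintype A] {s t : Finset A} (h : s.card = t.card) {x x' : A}
    (hx : x ∉ s) (hx' : x' ∉ t) :
    ∃ τ : Equiv.Perm A, τ x = x' ∧ ∀ a, τ a ∈ t ↔ a ∈ s := by
  obtain ⟨τ, hτ⟩ := exists_perm_mem_iff h
  exact ⟨_, by simp, exists_perm_mem_iff_of_apply_eq hτ hx hx'⟩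

theorem exists_perm_mem_iff_apply_apply [Fintype A] {s t : Finset A} (h : s.card = t.card)
    {x x' y y' : A} (hx : x ∉ s) (hx' : x' ∉ t) (hy : y ∉ s) (hy' : y' ∉ t) (hxy : x ≠ y)
    (hxy' : x' ≠ y') :
    ∃ τ : Equiv.Perm A, τ x = x' ∧ τ y = y' ∧ ∀ a, τ a ∈ t ↔ a ∈ s := by
  obtain ⟨τ, hτx, hτ⟩ := exists_perm_mem_iff_apply h hx hx'
  refine ⟨_, ?_, by simp, exists_perm_mem_iff_of_apply_eq hτ hy hy'⟩
  rw [Equiv.trans_apply, hτx, Equiv.swap_apply_of_ne_of_ne _ hxy']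
  rw [← hτx]
  exact τ.injective.ne hxy

theorem sum_update_sub [Fintype N] (V : N → Finset A) (i : N) (U : Finset A) (g : Finset A → ℝ) :
    ∑ j, g (Function.update V i U j) = ∑ j, g (V j) - g (V i) + g U := by
  rw [← Finset.add_sum_erase _ _ (Finset.mem_univ i),
    ← Finset.add_sum_erase _ (fun j => g (V j)) (Finset.mem_univ i)]
  rw [Finset.sum_congr rfl fun j hj => by rw [Function.update_of_ne (Finset.ne_of_mem_erase hj)]]
  rw [Function.update_self]
  ring

variable [Fintype A] [Fintype N] {f : SDS N A}

theorem drop_map (hf : Strategyproof f) (ha : Anonymous f) (hn : Neutral f) (τ : Equiv.Perm A)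
    (π : Equiv.Perm N) {x y : A} (hxy : x ≠ y) (i : N) (V : N → Finset A) (hx : ∀ j, x ∉ V j) :
    drop f (τ x) (τ y) (π i) (fun j => (V (π.symm j)).map τ.toEmbedding) = drop f x y i V := by
  unfold drop
  rw [← hn.upperValue_map hf τ x V hx,
    ← ha.upperValue_comp π (τ x) fun j => (V j).map τ.toEmbedding]
  rw [← hn.upperValue_map hf τ x (Function.update V i (insert y (V i))),
    ← ha.upperValue_comp π (τ x) fun j =>
      (Function.update V i (insert y (V i)) j).map τ.toEmbedding]
  · congr 2
    funext j
    by_cases hj : j = π i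
    · subst hj
      simp
    · have : π.symm j ≠ i := fun h => hj (by simp [← h])
      simp [hj, this]
  · intro j
    by_cases hj : j = i
    · subst hj
      simp [hxy, hx]
    · simp [hj, hx]

/-- For anonymous and neutral schemes, the loss of `x` depends only on the rank of `x` for the
voter who moves `y` above `x` and on the number of voters who already prefer `y`. -/
theorem drop_eq_drop (hf : Strategyproof f) (ha : Anonymous f) (hn : Neutral f)
    {x y x' y' : A} {i i' : N} {V V' : N → Finset A} (hxy : x ≠ y) (hxy' : x' ≠ y')
    (hx : ∀ j, x ∉ V j) (hx' : ∀ j, x' ∉ V' j) (hy : y ∉ V i) (hy' : y' ∉ V' i')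
    (hV : (V i).card = (V' i').card)
    (hc : Finset.card {j | y ∈ V j} = Finset.card {j | y' ∈ V' j}) :
    drop f x y i V = drop f x' y' i' V' := by
  obtain ⟨τ, rfl, rfl, hτ⟩ :=
    exists_perm_mem_iff_apply_apply hV (hx i) (hx' i') hy hy' hxy hxy'
  obtain ⟨π, rfl, hπ⟩ := exists_perm_mem_iff_apply hc (x := i) (x' := i')
    (by simpa using hy) (by simpa using hy')
  rw [← drop_map hf ha hn τ π hxy i V hx]
  refine hf.drop_congr hxy' _ _ _ (by simpa using fun j => hx _) hx' (by simpa using hy) ?_ ?_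
  · ext a
    have := hτ (τ.symm a)
    simp_all
  · intro j
    have := hπ (π.symm j)
    simp_all

theorem exists_drop_eq (hf : Strategyproof f) (ha : Anonymous f) (hn : Neutral f) :
    ∃ d : ℕ → ℕ → ℝ, (∀ k s, 0 ≤ d k s) ∧ ∀ (x y : A) (i : N) (V : N → Finset A), x ≠ y →
      (∀ j, x ∉ V j) → y ∉ V i →
      drop f x y i V = d (V i).card (Finset.card {j | y ∈ V j}) := by
  have key : ∀ k s : ℕ, ∃ c : ℝ, 0 ≤ c ∧ ∀ (x y : A) (i : N) (V : N → Finset A), x ≠ y →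
      (∀ j, x ∉ V j) → y ∉ V i → (V i).card = k → Finset.card {j | y ∈ V j} = s →
      drop f x y i V = c := by
    intro k s
    by_cases h : ∃ (x y : A) (i : N) (V : N → Finset A), x ≠ y ∧
      (∀ j, x ∉ V j) ∧ y ∉ V i ∧ (V i).card = k ∧ Finset.card {j | y ∈ V j} = s
    · obtain ⟨x, y, i, V, hxy, hx, hy, rfl, rfl⟩ := h
      exact ⟨drop f x y i V, (hf.drop_eq_sub hxy i V hx hy).1,
        fun x' y' i' V' hxy' hx' hy' hV hc =>
          drop_eq_drop hf ha hn hxy' hxy hx' hx hy' hy hV hc⟩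
    -- No configuration realises the pair `k`, `s`, so the value is irrelevant.
    · refine ⟨0, le_rfl, fun x y i V h₁ h₂ h₃ h₄ h₅ => ?_⟩
      exact absurd ⟨x, y, i, V, h₁, h₂, h₃, h₄, h₅⟩ h
  choose d hd hd' using key
  exact ⟨d, hd, fun x y i V h₁ h₂ h₃ => hd' _ _ x y i V h₁ h₂ h₃ rfl rfl⟩

/-! ### Additive decomposition of the losses -/

/-- Letting two voters move `y` above `x` in either order. -/
theorem drop_comm {d : ℕ → ℕ → ℝ}
    (hd : ∀ (x y : A) (i : N) (V : N → Finset A), x ≠ y → (∀ j, x ∉ V j) → y ∉ V i →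
      drop f x y i V = d (V i).card (Finset.card {j | y ∈ V j}))
    {k l s : ℕ} (hk : k + 2 ≤ Fintype.card A) (hl : l + 2 ≤ Fintype.card A)
    (hs : s + 2 ≤ Fintype.card N) : d k s + d l (s + 1) = d l s + d k (s + 1) := by
  obtain ⟨x, y, hxy⟩ := Fintype.one_lt_card_iff.1 (show 1 < Fintype.card A by omega)
  obtain ⟨i, j, hij⟩ := Fintype.one_lt_card_iff.1 (show 1 < Fintype.card N by omega)
  have hA : ({x, y}ᶜ : Finset A).card = Fintype.card A - 2 := by
    rw [Finset.card_compl, Finset.card_pair hxy]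
  have hN : ({i, j}ᶜ : Finset N).card = Fintype.card N - 2 := by
    rw [Finset.card_compl, Finset.card_pair hij]
  obtain ⟨K, hK, rfl⟩ := Finset.exists_subset_card_eq (show k ≤ ({x, y}ᶜ : Finset A).card by omega)
  obtain ⟨L, hL, rfl⟩ := Finset.exists_subset_card_eq (show l ≤ ({x, y}ᶜ : Finset A).card by omega)
  obtain ⟨S, hS, rfl⟩ := Finset.exists_subset_card_eq (show s ≤ ({i, j}ᶜ : Finset N).card by omega)
  have hxK : x ∉ K := fun h => by simpa using hK h
  have hyK : y ∉ K := fun h => by simpa using hK h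
  have hxL : x ∉ L := fun h => by simpa using hL h
  have hyL : y ∉ L := fun h => by simpa using hL h
  have hiS : i ∉ S := fun h => by simpa using hS h
  have hjS : j ∉ S := fun h => by simpa using hS h
  -- Voters `i` and `j` have `k` and `l` alternatives above `x`, none of them `y`; exactly the
  -- voters in `S` already prefer `y`.
  let V : N → Finset A := fun v => if v = i then K else if v = j then L else
    if v ∈ S then {y} else ∅
  have hVi : V i = K := by simp [V]
  have hVj : V j = L := by simp [V, hij.symm]
  have hxV : ∀ v, x ∉ V v := by
    intro v
    simp only [V]
    split_ifs <;> simp [hxK, hxL, hxy]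
  have hyV : ∀ v, y ∈ V v ↔ v ∈ S := by
    intro v
    simp only [V]
    split_ifs with h₁ h₂ h₃
    · subst h₁; simp [hyK, hiS]
    · subst h₂; simp [hyL, hjS]
    · simp [h₃]
    · simp [h₃]
  have hupd : ∀ u v, x ∉ Function.update V u (insert y (V u)) v := by
    intro u v
    by_cases h : v = u
    · subst h; simp [hxy, hxV]
    · simp [h, hxV]
  have hc : Finset.card {v | y ∈ V v} = S.card := by
    congr 1
    ext v
    simp [hyV]
  have hc' : ∀ u, u ∉ S → Finset.card {v | y ∈ Function.update V u (insert y (V u)) v} =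
      S.card + 1 := by
    intro u hu
    rw [← Finset.card_insert_of_notMem hu]
    congr 1
    ext v
    by_cases h : v = u
    · subst h; simp
    · simp [h, hyV]
  have h₁ := hd x y i V hxy hxV (by simp [hyV, hiS])
  have h₂ := hd x y j V hxy hxV (by simp [hyV, hjS])
  have h₃ := hd x y j (Function.update V i (insert y (V i))) hxy (hupd i)
    (by simp [hij.symm, hyV, hjS])
  have h₄ := hd x y i (Function.update V j (insert y (V j))) hxy (hupd j)
    (by simp [hij, hyV, hiS])
  rw [hc, hVi] at h₁
  rw [hc, hVj] at h₂
  rw [hc' i hiS, Function.update_of_ne hij.symm, hVj] at h₃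
  rw [hc' j hjS, Function.update_of_ne hij, hVi] at h₄
  rw [← h₁, ← h₂, ← h₃, ← h₄]
  unfold drop
  rw [Function.update_of_ne hij, Function.update_of_ne hij.symm,
    Function.update_comm hij.symm]
  ring

/-- By `drop_comm`, the difference `d k s - d l s` does not depend on `s`, so `d` splits into a rank
part and a support part. -/
theorem exists_drop_eq_add (hf : Strategyproof f) (ha : Anonymous f) (hn : Neutral f)
    (hA : 2 ≤ Fintype.card A) :
    ∃ a b : ℕ → ℝ, (∀ k, 0 ≤ a k) ∧ (∀ s, 0 ≤ b s) ∧
      ∀ (x y : A) (i : N) (V : N → Finset A), x ≠ y → (∀ j, x ∉ V j) → y ∉ V i →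
      drop f x y i V = a (V i).card + b (Finset.card {j | y ∈ V j}) := by
  obtain ⟨d, hd0, hd⟩ := exists_drop_eq hf ha hn
  -- Taking the minimiser of `d k 0` as reference rank makes the rank part nonnegative.
  obtain ⟨l, hl, hmin⟩ := Finset.exists_min_image (Finset.range (Fintype.card A - 1))
    (fun k => d k 0) ⟨0, by simp; omega⟩
  rw [Finset.mem_range] at hl
  have key : ∀ k < Fintype.card A - 1, ∀ s < Fintype.card N, d k s = d k 0 - d l 0 + d l s := by
    intro k hk s
    induction s with
    | zero => intro _; ring
    | succ s ih =>
      intro hs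
      have := drop_comm hd (k := k) (l := l) (s := s) (by omega) (by omega) (by omega)
      have := ih (by omega)
      linarith
  refine ⟨fun k => if k < Fintype.card A - 1 then d k 0 - d l 0 else 0, d l, fun k => ?_, hd0 l,
    fun x y i V hxy hx hy => ?_⟩
  · beta_reduce
    split_ifs with hk
    · exact sub_nonneg.2 (hmin k (Finset.mem_range.2 hk))
    · exact le_rfl
  · have h₁ : (V i).card < Fintype.card A - 1 := by
      have h₁ : V i ⊆ {x, y}ᶜ := by
        intro a h
        have := hx i
        simp only [Finset.mem_compl, Finset.mem_insert, Finset.mem_singleton]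
        rintro (rfl | rfl) <;> contradiction
      have := Finset.card_le_card h₁
      rw [Finset.card_compl, Finset.card_pair hxy] at this
      omega
    have h₂ : Finset.card {j | y ∈ V j} < Fintype.card N := by
      rw [← Finset.card_univ]
      refine Finset.card_lt_card (Finset.filter_ssubset.2 ⟨i, Finset.mem_univ i, hy⟩)
    rw [hd x y i V hxy hx hy, key _ h₁ _ h₂]
    simp only [if_pos h₁]

/-- Starting from unanimous top rank, whose value is the same for all alternatives by neutrality,
any configuration is reached by lifting alternatives above `x` one at a time. The functions `p` and
`q` are the partial sums of the losses incurred. -/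
theorem exists_upperValue_eq [Nonempty A] (hf : Strategyproof f) (ha : Anonymous f)
    (hn : Neutral f) (hA : 2 ≤ Fintype.card A) :
    ∃ (c : ℝ) (p q : ℕ → ℝ), Monotone p ∧ Monotone q ∧ p 0 = 0 ∧ q 0 = 0 ∧
      ∀ (x : A) (V : N → Finset A), (∀ j, x ∉ V j) →
      upperValue f x V = c - ∑ i, p (V i).card - ∑ y, q (Finset.card {j | y ∈ V j}) := by
  obtain ⟨a, b, ha0, hb0, hab⟩ := exists_drop_eq_add hf ha hn hA
  obtain ⟨x₀⟩ := ‹Nonempty A›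
  refine ⟨upperValue f x₀ fun _ => ∅, fun k => ∑ l ∈ Finset.range k, a l,
    fun s => ∑ l ∈ Finset.range s, b l, ?_, ?_, by simp, by simp, ?_⟩
  · exact monotone_nat_of_le_succ fun k => by simp [Finset.sum_range_succ, ha0]
  · exact monotone_nat_of_le_succ fun k => by simp [Finset.sum_range_succ, hb0]
  intro x V hx
  induction hN : ∑ i, (V i).card generalizing V with
  | zero =>
    have hV : V = fun _ => ∅ := by
      funext i
      simpa using Finset.sum_eq_zero_iff.1 hN i
    subst hV
    rw [← hn.upperValue_map hf (Equiv.swap x x₀) x _ hx]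
    simp
  | succ t ih =>
    obtain ⟨i, hi⟩ : ∃ i, V i ≠ ∅ := by
      by_contra! h
      simp [h] at hN
    obtain ⟨y, hy⟩ := Finset.nonempty_iff_ne_empty.2 hi
    have hxy : x ≠ y := fun h => hx i (h ▸ hy)
    -- Undo one lift: `W` has total size `t`, and `V` arises from it when `i` lifts `y`.
    let W := Function.update V i ((V i).erase y)
    have hWi : W i = (V i).erase y := by simp [W]
    have hWV : Function.update W i (insert y (W i)) = V := by
      rw [hWi, Finset.insert_erase hy]
      simp [W]
    have hyW : y ∉ W i := by simp [hWi]
    have hxW : ∀ j, x ∉ W j := by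
      intro j
      by_cases h : j = i
      · subst h; simp [hWi, hx]
      · simp [W, h, hx]
    have hins : (insert y (W i)).card = (W i).card + 1 := Finset.card_insert_of_notMem hyW
    have hcard : ∑ j, (W j).card = t := by
      have h : ∑ j, ((V j).card : ℝ) = ∑ j, ((W j).card : ℝ) - (W i).card + ((W i).card + 1) := by
        rw [← hWV, sum_update_sub W i _ fun U => (U.card : ℝ), hins]
        push_cast
        ring
      have hN' : (∑ j, ((V j).card : ℝ)) = t + 1 := by exact_mod_cast hN
      rw [hN'] at h
      have : (∑ j, ((W j).card : ℝ)) = t := by linarith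
      exact_mod_cast this
    have hd := hab x y i W hxy hxW hyW
    rw [drop, hWV, ih W hxW hcard] at hd
    have h₁ : ∑ j, ∑ l ∈ Finset.range (V j).card, a l =
        ∑ j, ∑ l ∈ Finset.range (W j).card, a l + a (W i).card := by
      conv_lhs => rw [← hWV]
      rw [sum_update_sub W i _ fun U => ∑ l ∈ Finset.range U.card, a l, hins,
        Finset.sum_range_succ]
      ring
    have h₂ : ∑ z, ∑ l ∈ Finset.range (Finset.card {j | z ∈ V j}), b l =
        ∑ z, ∑ l ∈ Finset.range (Finset.card {j | z ∈ W j}), b l +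
          b (Finset.card {j | y ∈ W j}) := by
      rw [← Finset.add_sum_erase _ _ (Finset.mem_univ y),
        ← Finset.add_sum_erase (a := y) _ (fun z =>
          ∑ l ∈ Finset.range (Finset.card {j | z ∈ W j}), b l) (Finset.mem_univ y)]
      have e₁ : Finset.card {j | y ∈ V j} = Finset.card {j | y ∈ W j} + 1 := by
        rw [← Finset.card_insert_of_notMem (a := i) (by simpa using hyW)]
        congr 1
        ext j
        by_cases h : j = i
        · subst h; simp [hy]
        · simp [W, h]
      have e₂ : ∀ z ∈ Finset.univ.erase y,
          ∑ l ∈ Finset.range (Finset.card {j | z ∈ V j}), b l =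
          ∑ l ∈ Finset.range (Finset.card {j | z ∈ W j}), b l := by
        intro z hz
        congr 3
        ext j
        by_cases h : j = i
        · subst h; simp [hWi, Finset.ne_of_mem_erase hz]
        · simp [W, h]
      rw [Finset.sum_congr rfl e₂, e₁, Finset.sum_range_succ]
      ring
    rw [h₁, h₂]
    linarith

/-- Every anonymous, neutral and strategyproof scheme is, up to a constant, a sum of a point
voting scheme and a supporting size scheme. -/
theorem exists_apply_eq [Nonempty A] (hf : Strategyproof f) (ha : Anonymous f)
    (hn : Neutral f) (hA : 2 ≤ Fintype.card A) :
    ∃ (c : ℝ) (p q : ℕ → ℝ), Monotone p ∧ Monotone q ∧ p 0 = 0 ∧ q 0 = 0 ∧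
      ∀ (R : Profile N A) (x : A),
      (f R).1 x = c - ∑ i, p ((R i).upper x).card - ∑ y, q (supportingSize R y x) := by
  obtain ⟨c, p, q, hp, hq, hp0, hq0, h⟩ := exists_upperValue_eq hf ha hn hA
  refine ⟨c, p, q, hp, hq, hp0, hq0, fun R x => ?_⟩
  rw [hf.apply_eq_upperValue (V := fun i => (R i).upper x) fun _ => rfl, h]
  · simp [supportingSize]
  · exact fun j => (R j).notMem_upper_self x

end

/-! ### Test profiles and the resulting inequalities -/

section

open Classical

variable {N A : Type*} [Fintype N]

theorem supportingSize_self (R : Profile N A) (x : A) : supportingSize R x x = 0 := by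
  simp [supportingSize, fun i => (R i).irrefl x]

theorem supportingSize_add (R : Profile N A) {x y : A} (hxy : x ≠ y) :
    supportingSize R x y + supportingSize R y x = Fintype.card N := by
  have h : ∀ i, (R i).prefers y x ↔ ¬ (R i).prefers x y := fun i =>
    ⟨fun h h' => (R i).irrefl x ((R i).trans _ _ _ h' h), ((R i).complete x y hxy).resolve_left⟩
  unfold supportingSize
  simp only [h]
  rw [Finset.card_filter_add_card_filter_not, Finset.card_univ]

/-- Voters can split their favourites among three alternatives so that none of these is the
favourite of half of them, and the first one is as close to that as possible. -/
theorem exists_fun_card_fiber (hn : 5 ≤ Fintype.card N) {y₁ y₂ y₃ : A} (h₁₂ : y₁ ≠ y₂)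
    (h₁₃ : y₁ ≠ y₃) (h₂₃ : y₂ ≠ y₃) :
    ∃ t : N → A, (∀ i, t i = y₁ ∨ t i = y₂ ∨ t i = y₃) ∧
      Finset.card {i | t i = y₁} = (Fintype.card N - 1) / 2 ∧
      ∀ z, Finset.card {i | t i = z} ≤ (Fintype.card N - 1) / 2 := by
  obtain ⟨S, -, hS⟩ := Finset.exists_subset_card_eq (s := (Finset.univ : Finset N))
    (n := (Fintype.card N - 1) / 2) (by rw [Finset.card_univ]; omega)
  -- Outside `S` and `T` one voter remains if n is odd and two if n is even. From n ≥ 5 on, this is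
  -- at most (n-1)/2 rounded down; for n = 4 it is not.
  obtain ⟨T, hT, hT'⟩ := Finset.exists_subset_card_eq (s := Sᶜ)
    (n := (Fintype.card N - 1) / 2) (by rw [Finset.card_compl]; omega)
  have hST : Disjoint S T := by
    rw [Finset.disjoint_left]
    exact fun a h h' => by simpa [h] using hT h'
  let t : N → A := fun i => if i ∈ S then y₁ else if i ∈ T then y₂ else y₃
  have ht₁ : ∀ i, t i = y₁ ↔ i ∈ S := by
    intro i
    simp only [t]
    split_ifs <;> simp_all [h₁₂.symm, h₁₃.symm]
  have ht₂ : ∀ i, t i = y₂ ↔ i ∈ T := by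
    intro i
    simp only [t]
    split_ifs with h
    · simp [h₁₂, Finset.disjoint_left.1 hST h]
    all_goals simp_all [h₂₃.symm]
  have ht₃ : ∀ i, t i = y₃ ↔ i ∈ (S ∪ T)ᶜ := by
    intro i
    simp only [t]
    split_ifs <;> simp_all
  refine ⟨t, fun i => ?_, ?_, fun z => ?_⟩
  · simp only [t]
    split_ifs <;> simp
  · rw [← hS]
    congr 1
    ext i
    simp [ht₁]
  · by_cases hz₁ : z = y₁
    · subst hz₁
      simp [ht₁, hS]
    by_cases hz₂ : z = y₂
    · subst hz₂
      simp [ht₂, hT']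
    by_cases hz₃ : z = y₃
    · subst hz₃
      have : Finset.card {i | t i = z} = (S ∪ T)ᶜ.card := by
        congr 1
        ext i
        rw [Finset.mem_filter_univ, ht₃]
      rw [this, Finset.card_compl, Finset.card_union_of_disjoint hST]
      omega
    · have : Finset.card {i | t i = z} = 0 := by
        rw [Finset.card_eq_zero, Finset.filter_eq_empty_iff]
        intro i _
        simp only [t]
        split_ifs <;> simp_all [eq_comm]
      omega

variable [Fintype A]

theorem supportingSize_eq_card_mem_upper (R : Profile N A) (x y : A) :
    supportingSize R y x = Finset.card {i | y ∈ (R i).upper x} := by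
  simp [supportingSize]

variable {f : SDS N A} {c : ℝ} {p q : ℕ → ℝ}

/-- The alternative that everybody ranks last has nonnegative probability. -/
theorem le_const_of_apply_eq [Nonempty A] (hq0 : q 0 = 0)
    (h : ∀ (R : Profile N A) (x : A),
      (f R).1 x = c - ∑ i, p ((R i).upper x).card - ∑ y, q (supportingSize R y x)) :
    Fintype.card N * p (Fintype.card A - 1) + ((Fintype.card A : ℝ) - 1) * q (Fintype.card N) ≤
      c := by
  obtain ⟨x⟩ := ‹Nonempty A›
  have h₀ := h (fun _ => Pref.ofUpper x (Finset.univ.erase x)) x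
  have h₁ := (f fun _ => Pref.ofUpper x (Finset.univ.erase x)).2.1 x
  simp only [supportingSize_eq_card_mem_upper] at h₀
  have hA : 1 ≤ Fintype.card A := Fintype.card_pos
  have hs : ∑ y, q (Finset.card {_i : N | y ∈ Finset.univ.erase x}) =
      ((Fintype.card A : ℝ) - 1) * q (Fintype.card N) := by
    rw [← Finset.add_sum_erase _ _ (Finset.mem_univ x),
      Finset.sum_congr (s₁ := Finset.univ.erase x) (g := fun _ => q (Fintype.card N)) rfl
        fun y hy => by simp [Finset.ne_of_mem_erase hy, Finset.card_univ]]
    simp [hq0, Finset.card_erase_of_mem, Finset.card_univ, Nat.cast_sub hA]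
  rw [h₀, Pref.upper_ofUpper (by simp), hs, Finset.card_erase_of_mem (Finset.mem_univ x),
    Finset.sum_const, Finset.card_univ, Finset.card_univ, nsmul_eq_mul] at h₁
  linarith

/-- Test profile: all voters rank the same `y` first and `x` second. -/
theorem ExPostEfficient.const_sub_le [Nontrivial A] {β : ℝ} (hβ : ExPostEfficient β f)
    (hq0 : q 0 = 0) (h : ∀ (R : Profile N A) (x : A),
      (f R).1 x = c - ∑ i, p ((R i).upper x).card - ∑ y, q (supportingSize R y x)) :
    c - Fintype.card N * p 1 - q (Fintype.card N) ≤ β := by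
  obtain ⟨x, y, hxy⟩ := exists_pair_ne A
  have hup : (Pref.ofUpper x {y}).upper x = {y} := Pref.upper_ofUpper (by simpa using hxy)
  have h₁ := hβ (fun _ => Pref.ofUpper x {y}) x
    ⟨y, fun _ => by rw [← Pref.mem_upper, hup, Finset.mem_singleton]⟩
  have h₀ := h (fun _ => Pref.ofUpper x {y}) x
  simp only [supportingSize_eq_card_mem_upper] at h₀
  rw [h₀, hup, Finset.sum_eq_single (a := y)] at h₁
  · simpa [Finset.card_univ] using h₁
  · intro z _ hz
    simp [hz, hq0]
  · simp

/-- Test profile: all voters rank `x` second, and their favourites are split among three others so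
that none beats `x`. Thus `x` is a Condorcet winner that is never top-ranked. Only the largest
group's term in `q` is kept. -/
theorem CondorcetConsistent.le_const_sub {α : ℝ} (hα : CondorcetConsistent α f)
    (hm : 4 ≤ Fintype.card A) (hn : 5 ≤ Fintype.card N) (hq : Monotone q)
    (hq0 : q 0 = 0) (h : ∀ (R : Profile N A) (x : A),
      (f R).1 x = c - ∑ i, p ((R i).upper x).card - ∑ y, q (supportingSize R y x)) :
    α ≤ c - Fintype.card N * p 1 - q ((Fintype.card N - 1) / 2) := by
  obtain ⟨e⟩ := Function.Embedding.nonempty_of_card_le (α := Fin 4) (β := A) (by simpa using hm)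
  have he : ∀ a b, a ≠ b → e a ≠ e b := fun a b hab => e.injective.ne hab
  obtain ⟨t, ht, ht₁, htz⟩ := exists_fun_card_fiber (N := N) hn (he 1 2 (by decide))
    (he 1 3 (by decide)) (he 2 3 (by decide))
  have htx : ∀ i, e 0 ∉ ({t i} : Finset A) := by
    intro i
    rw [Finset.mem_singleton]
    rcases ht i with hi | hi | hi <;> rw [hi] <;> exact he _ _ (by decide)
  have hs : ∀ y, supportingSize (fun i => Pref.ofUpper (e 0) {t i}) y (e 0) =
      Finset.card {i | t i = y} := by
    intro y
    rw [supportingSize_eq_card_mem_upper]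
    congr 1
    ext i
    rw [Finset.mem_filter_univ, Finset.mem_filter_univ, Pref.upper_ofUpper (htx i),
      Finset.mem_singleton, eq_comm]
  have h₁ := hα (fun i => Pref.ofUpper (e 0) {t i}) (e 0) fun y hy => by
    have h₂ := supportingSize_add (fun i => Pref.ofUpper (e 0) {t i}) hy
    have h₃ := htz y
    rw [hs] at h₂ ⊢
    omega
  rw [h] at h₁
  have h₄ : q ((Fintype.card N - 1) / 2) ≤
      ∑ y, q (supportingSize (fun i => Pref.ofUpper (e 0) {t i}) y (e 0)) := by
    rw [← ht₁, ← hs]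
    exact Finset.single_le_sum
      (f := fun y => q (supportingSize (fun i => Pref.ofUpper (e 0) {t i}) y (e 0)))
      (fun y _ => by rw [← hq0]; exact hq (Nat.zero_le _)) (Finset.mem_univ (e 1))
  rw [Finset.sum_congr (g := fun _ => p 1) rfl fun i _ => by
    rw [Pref.upper_ofUpper (htx i), Finset.card_singleton]] at h₁
  simp only [Finset.sum_const, Finset.card_univ, nsmul_eq_mul] at h₁
  linarith

theorem sum_ite_mem_const (J : Finset N) (a b : ℝ) :
    ∑ i, (if i ∈ J then a else b) = J.card * a + (Fintype.card N - J.card) * b := by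
  rw [Finset.sum_ite]
  have : ((Finset.univ.filter fun i => i ∉ J).card : ℝ) = Fintype.card N - J.card := by
    rw [← Finset.compl_filter, Finset.card_compl, Nat.cast_sub (Finset.card_le_univ _)]
    simp
  simp [this]

/-- Let `x` and `y` occupy the top two places for everybody. The voters' order of these two does not
affect the other alternatives, so the joint probability of `x` and `y` is constant; comparing a
split of j against n - j voters with unanimity gives the identity. -/
theorem Strategyproof.add_eq_of_apply_eq [Nontrivial A] (hf : Strategyproof f) (hp0 : p 0 = 0)
    (hq0 : q 0 = 0) (h : ∀ (R : Profile N A) (x : A),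
      (f R).1 x = c - ∑ i, p ((R i).upper x).card - ∑ y, q (supportingSize R y x))
    {j : ℕ} (hj : j ≤ Fintype.card N) : q j + q (Fintype.card N - j) = q (Fintype.card N) := by
  obtain ⟨x, y, hxy⟩ := exists_pair_ne A
  let l : A → A → A → ℕ := fun u v a => if a = u then 0 else if a = v then 1 else 2
  have hu : ∀ u v, u ≠ v → (Pref.ofLevel (l u v)).upper u = ∅ := by
    intro u v huv
    ext a
    rw [Pref.mem_upper]
    simp only [Pref.ofLevel, l]
    by_cases ha : a = u <;> by_cases ha' : a = v <;> simp_all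
  have hv : ∀ u v, u ≠ v → (Pref.ofLevel (l u v)).upper v = {u} := by
    intro u v huv
    ext a
    rw [Pref.mem_upper]
    simp only [Pref.ofLevel, l]
    by_cases ha : a = u <;> by_cases ha' : a = v <;> simp_all [huv.symm]
  have hz : ∀ z, z ≠ x → z ≠ y →
      (Pref.ofLevel (l x y)).upper z = (Pref.ofLevel (l y x)).upper z := by
    intro z hzx hzy
    ext a
    rw [Pref.mem_upper, Pref.mem_upper]
    simp only [Pref.ofLevel, l]
    by_cases ha : a = x <;> by_cases ha' : a = y <;> simp_all
  obtain ⟨J, -, rfl⟩ := Finset.exists_subset_card_eq (s := (Finset.univ : Finset N)) (n := j)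
    (by rwa [Finset.card_univ])
  let R : Finset N → Profile N A := fun J i =>
    if i ∈ J then Pref.ofLevel (l x y) else Pref.ofLevel (l y x)
  have hRx : ∀ J i, (R J i).upper x = if i ∈ J then ∅ else {y} := by
    intro J i
    simp only [R]
    split_ifs
    · exact hu x y hxy
    · exact hv y x hxy.symm
  have hRy : ∀ J i, (R J i).upper y = if i ∈ J then {x} else ∅ := by
    intro J i
    simp only [R]
    split_ifs
    · exact hv x y hxy
    · exact hu y x hxy.symm
  have hfx : ∀ J, (f (R J)).1 x = c - (Fintype.card N - J.card) * p 1 -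
      q (Fintype.card N - J.card) := by
    intro J
    rw [h, Finset.sum_eq_single (a := y)]
    · have : supportingSize (R J) y x = Fintype.card N - J.card := by
        rw [supportingSize_eq_card_mem_upper, ← Finset.card_compl]
        congr 1
        ext i
        by_cases hi : i ∈ J <;> simp [hRx, hi]
      have h' := sum_ite_mem_const J (p 0) (p 1)
      simp only [hRx, apply_ite Finset.card, apply_ite p, Finset.card_empty,
        Finset.card_singleton, this]
      rw [h', hp0]
      ring
    · intro z _ hz
      rw [supportingSize_eq_card_mem_upper, Finset.filter_false_of_mem, Finset.card_empty, hq0]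
      intro i _
      rw [hRx]
      split_ifs <;> simp [hz]
    · simp
  have hfy : ∀ J, (f (R J)).1 y = c - J.card * p 1 - q J.card := by
    intro J
    rw [h, Finset.sum_eq_single (a := x)]
    · have : supportingSize (R J) x y = J.card := by
        rw [supportingSize_eq_card_mem_upper]
        congr 1
        ext i
        by_cases hi : i ∈ J <;> simp [hRy, hi]
      have h' := sum_ite_mem_const J (p 1) (p 0)
      simp only [hRy, apply_ite Finset.card, apply_ite p, Finset.card_empty,
        Finset.card_singleton, this]
      rw [h', hp0]
      ring
    · intro z _ hz
      rw [supportingSize_eq_card_mem_upper, Finset.filter_false_of_mem, Finset.card_empty, hq0]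
      intro i _
      rw [hRy]
      split_ifs <;> simp [hz]
    · simp
  have hsum : (f (R J)).1 x + (f (R J)).1 y =
      (f (R Finset.univ)).1 x + (f (R Finset.univ)).1 y := by
    have hs : ∀ K, (f (R K)).1 x + ((f (R K)).1 y +
        ∑ z ∈ (Finset.univ.erase x).erase y, (f (R K)).1 z) = 1 := by
      intro K
      rw [Finset.add_sum_erase _ _ (by simpa using hxy.symm),
        Finset.add_sum_erase _ _ (Finset.mem_univ x)]
      exact (f (R K)).2.2
    have hrest : ∑ z ∈ (Finset.univ.erase x).erase y, (f (R J)).1 z =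
        ∑ z ∈ (Finset.univ.erase x).erase y, (f (R Finset.univ)).1 z := by
      refine Finset.sum_congr rfl fun z hz' => hf.apply_eq_of_upper_eq fun i => ?_
      simp only [R, Finset.mem_univ, if_true]
      split_ifs
      · rfl
      · simp only [Finset.mem_erase] at hz'
        exact (hz z hz'.2.1 hz'.1).symm
    have h₁ := hs J
    have h₂ := hs Finset.univ
    linarith
  rw [hfx, hfy, hfx, hfy, Finset.card_univ, Nat.sub_self, hq0] at hsum
  linarith

/-! ### The equality case: recognising the mixture -/

theorem Pref.isTop_iff_upper_eq_empty (P : Pref A) (x : A) : P.IsTop x ↔ P.upper x = ∅ := by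
  rw [Finset.eq_empty_iff_forall_notMem]
  simp only [Pref.mem_upper]
  refine ⟨fun h y hy => ?_, fun h y hy => (P.complete x y hy.symm).resolve_right (h y)⟩
  by_cases hyx : y = x
  · subst hyx
    exact P.irrefl _ hy
  · exact P.irrefl x (P.trans _ _ _ (h y hyx) hy)

theorem card_upper_le (P : Pref A) (x : A) : (P.upper x).card ≤ Fintype.card A - 1 := by
  rw [← Finset.card_univ, ← Finset.card_erase_of_mem (Finset.mem_univ x)]
  refine Finset.card_le_card fun a ha => ?_
  rw [Finset.mem_erase]
  exact ⟨fun h => P.notMem_upper_self x (h ▸ ha), Finset.mem_univ a⟩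

theorem copelandScore_eq_sum (R : Profile N A) (x : A) :
    copelandScore R x = ∑ y ∈ Finset.univ.erase x,
      ((if supportingSize R y x < supportingSize R x y then (1 : ℝ) else 0) +
        1 / 2 * if supportingSize R x y = supportingSize R y x then (1 : ℝ) else 0) := by
  rw [Finset.sum_add_distrib, ← Finset.mul_sum, Finset.sum_boole, Finset.sum_boole]
  unfold copelandScore
  refine congrArg₂ (fun a b : ℕ => (a : ℝ) + 1 / 2 * (b : ℝ)) ?_ ?_ <;>
  · refine congrArg _ (Finset.ext fun y => ?_)
    simp

/-- Monotonicity makes `p` constant on ranks below the top and `q` zero below n/2; the symmetry of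
`q` then gives q(n)/2 at a tie and q(n) above it. These are the penalties of random dictatorship and
of the Copeland score. -/
theorem exists_eq_mixture [Nonempty N] [Nontrivial A] (hp : Monotone p) (hq : Monotone q)
    (hp0 : p 0 = 0) (hq0 : q 0 = 0) (h : ∀ (R : Profile N A) (x : A),
      (f R).1 x = c - ∑ i, p ((R i).upper x).card - ∑ y, q (supportingSize R y x))
    (hsymm : ∀ j ≤ Fintype.card N, q j + q (Fintype.card N - j) = q (Fintype.card N))
    (hpc : p (Fintype.card A - 1) = p 1) (hqc : q ((Fintype.card N - 1) / 2) = 0)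
    (hc : c = Fintype.card N * p 1 + ((Fintype.card A : ℝ) - 1) * q (Fintype.card N)) :
    ∃ l : Set.Icc (0 : ℝ) 1,
      f = mixture l (uniformRandomDictatorship N A) (randomizedCopeland N A) := by
  have hq_nonneg : ∀ k, 0 ≤ q k := fun k => by rw [← hq0]; exact hq (Nat.zero_le k)
  have hp1 : 0 ≤ p 1 := by rw [← hp0]; exact hp (Nat.zero_le 1)
  have hN : (Fintype.card N : ℝ) ≠ 0 := by simp
  have hpt : ∀ (R : Profile N A) (x : A), ∑ i, p ((R i).upper x).card =
      (Fintype.card N - Finset.card {i | (R i).IsTop x}) * p 1 := by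
    intro R x
    have h' := sum_ite_mem_const (Finset.univ.filter fun i => (R i).IsTop x) 0 (p 1)
    rw [mul_zero, zero_add] at h'
    rw [← h']
    refine Finset.sum_congr rfl fun i _ => ?_
    simp only [Finset.mem_filter_univ, Pref.isTop_iff_upper_eq_empty]
    split_ifs with hi
    · rw [hi, Finset.card_empty, hp0]
    · have h₁ : 1 ≤ ((R i).upper x).card :=
        Finset.card_pos.2 (Finset.nonempty_iff_ne_empty.2 hi)
      exact le_antisymm (hpc ▸ hp (card_upper_le _ _)) (hp h₁)
  have hqlow : ∀ j, 2 * j < Fintype.card N → q j = 0 := fun j hj =>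
    le_antisymm (hqc ▸ hq (by omega)) (hq_nonneg j)
  have hqs : ∀ (R : Profile N A) (x : A), ∑ y, q (supportingSize R y x) =
      ((Fintype.card A : ℝ) - 1) * q (Fintype.card N) -
        q (Fintype.card N) * copelandScore R x := by
    intro R x
    have hA : 1 ≤ Fintype.card A := Fintype.card_pos
    rw [← Finset.add_sum_erase _ _ (Finset.mem_univ x), supportingSize_self, hq0, zero_add,
      copelandScore_eq_sum, Finset.mul_sum, eq_sub_iff_add_eq, ← Finset.sum_add_distrib]
    rw [Finset.sum_congr (g := fun _ => q (Fintype.card N)) rfl]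
    · simp [Finset.card_erase_of_mem, Finset.card_univ, Nat.cast_sub hA]
    intro y hy
    have hadd := supportingSize_add R (Finset.ne_of_mem_erase hy)
    have hs := hsymm (supportingSize R y x) (by omega)
    rw [← hadd, Nat.add_sub_cancel_left, hadd] at hs
    rcases lt_trichotomy (supportingSize R y x) (supportingSize R x y) with hlt | heq | hgt
    · rw [if_pos hlt, if_neg hlt.ne', hqlow _ (by omega)]
      ring
    · rw [if_neg heq.not_lt, if_pos heq.symm]
      rw [← heq] at hs
      linarith
    · rw [if_neg hgt.not_gt, if_neg hgt.ne]
      rw [hqlow (supportingSize R x y) (by omega)] at hs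
      linarith
  have hform : ∀ (R : Profile N A) (x : A), (f R).1 x =
      Fintype.card N * p 1 * (uniformRandomDictatorship N A R).1 x +
        q (Fintype.card N) * (∑ y, copelandScore R y) * (randomizedCopeland N A R).1 x := by
    intro R x
    have hS := (sum_copelandScore_pos R).ne'
    rw [h, hpt, hqs, hc]
    simp only [uniformRandomDictatorship, randomizedCopeland]
    field_simp
    ring
  -- Summing `hform` over `x` shows that the two weights add up to 1, without computing the total
  -- Copeland score.
  have hone : ∀ R : Profile N A,
      Fintype.card N * p 1 + q (Fintype.card N) * (∑ y, copelandScore R y) = 1 := by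
    intro R
    have h₁ := (f R).2.2
    have h₂ := (uniformRandomDictatorship N A R).2.2
    have h₃ := (randomizedCopeland N A R).2.2
    have h₄ : ∑ x, (f R).1 x = _ := Finset.sum_congr rfl fun x _ => hform R x
    rw [Finset.sum_add_distrib, ← Finset.mul_sum, ← Finset.mul_sum] at h₄
    rw [← h₁, ← mul_one (Fintype.card N * p 1), ← h₂,
      ← mul_one (q (Fintype.card N) * _), ← h₃]
    exact h₄.symm
  have hle : Fintype.card N * p 1 ≤ 1 := by
    have R : Profile N A := fun _ => Pref.ofLevel fun _ => 0
    rw [← hone R]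
    have := mul_nonneg (hq_nonneg (Fintype.card N)) (sum_copelandScore_pos R).le
    linarith
  refine ⟨⟨Fintype.card N * p 1, by positivity, hle⟩, ?_⟩
  funext R
  refine Subtype.ext (funext fun x => ?_)
  rw [hform]
  simp only [mixture]
  rw [← eq_sub_of_add_eq' (hone R)]

end

/-! ### Symmetrization by averaging over relabellings -/

section

open Classical

variable {N A : Type*}

theorem supportingSize_permute [Fintype N] (R : Profile N A) (π : Equiv.Perm N) (τ : Equiv.Perm A)
    (x y : A) : supportingSize (permuteVoters π (permuteAlternatives τ R)) (τ x) (τ y) =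
      supportingSize R x y := by
  unfold supportingSize
  refine Finset.card_equiv π.symm fun i => ?_
  simp [permuteVoters, permuteAlternatives, Pref.permute]

variable [Fintype A]

/-- The scheme `f` after renaming voters and alternatives. -/
noncomputable def SDS.relabel (f : SDS N A) (π : Equiv.Perm N) (τ : Equiv.Perm A) : SDS N A :=
  fun R => ⟨fun x => (f (permuteVoters π (permuteAlternatives τ R))).1 (τ x),
    fun _ => (f _).2.1 _, by
      rw [Equiv.sum_comp τ (f (permuteVoters π (permuteAlternatives τ R))).1]
      exact (f _).2.2⟩

theorem Strategyproof.relabel {f : SDS N A} (hf : Strategyproof f) (π : Equiv.Perm N)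
    (τ : Equiv.Perm A) : Strategyproof (f.relabel π τ) := by
  intro R R' i h x
  have key := hf (permuteVoters π (permuteAlternatives τ R))
    (permuteVoters π (permuteAlternatives τ R')) (π i)
    (fun j hj => congrArg (Pref.permute τ) (h _ fun e => hj (by simp [← e]))) (τ x)
  have hs : ∀ Q : Profile N A,
      ∑ y with (permuteVoters π (permuteAlternatives τ R) (π i)).prefers y (τ x), (f Q).1 y =
      ∑ y with (R i).prefers y x, (f Q).1 (τ y) := by
    intro Q
    rw [Finset.sum_filter, Finset.sum_filter, ← Equiv.sum_comp τ]
    simp [permuteVoters, permuteAlternatives, Pref.permute]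
  rw [hs, hs] at key
  exact key

theorem ExPostEfficient.relabel {f : SDS N A} {β : ℝ} (hf : ExPostEfficient β f)
    (π : Equiv.Perm N) (τ : Equiv.Perm A) : ExPostEfficient β (f.relabel π τ) := by
  rintro R x ⟨y, hy⟩
  refine hf _ (τ x) ⟨τ y, fun i => ?_⟩
  simpa [permuteVoters, permuteAlternatives, Pref.permute] using hy _

/-- The average of all relabellings of `f`. -/
noncomputable def SDS.symmetrize [Fintype N] (f : SDS N A) : SDS N A := fun R =>
  ⟨fun x => (∑ g : Equiv.Perm N × Equiv.Perm A, (f.relabel g.1 g.2 R).1 x) /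
      Fintype.card (Equiv.Perm N × Equiv.Perm A), by
    refine ⟨fun x => div_nonneg (Finset.sum_nonneg fun g _ => (f.relabel g.1 g.2 R).2.1 x)
      (Nat.cast_nonneg _), ?_⟩
    rw [← Finset.sum_div, Finset.sum_comm,
      Finset.sum_congr rfl fun g _ => (f.relabel g.1 g.2 R).2.2]
    simp⟩

variable [Fintype N] {f : SDS N A}

theorem SDS.symmetrize_apply (f : SDS N A) (R : Profile N A) (x : A) :
    (f.symmetrize R).1 x = (∑ g : Equiv.Perm N × Equiv.Perm A, (f.relabel g.1 g.2 R).1 x) /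
      Fintype.card (Equiv.Perm N × Equiv.Perm A) := rfl

theorem CondorcetConsistent.relabel {α : ℝ} (hf : CondorcetConsistent α f)
    (π : Equiv.Perm N) (τ : Equiv.Perm A) : CondorcetConsistent α (f.relabel π τ) := by
  intro R x hx
  refine hf _ (τ x) fun y hy => ?_
  have := hx (τ.symm y) fun e => hy (by simp [← e])
  rwa [← supportingSize_permute R π τ, ← supportingSize_permute R π τ,
    Equiv.apply_symm_apply] at this

theorem Strategyproof.symmetrize (hf : Strategyproof f) : Strategyproof f.symmetrize := by
  intro R R' i h x
  simp only [SDS.symmetrize_apply]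
  rw [← Finset.sum_div, ← Finset.sum_div]
  refine div_le_div_of_nonneg_right ?_ (Nat.cast_nonneg _)
  conv_lhs => rw [Finset.sum_comm]
  conv_rhs => rw [Finset.sum_comm]
  exact Finset.sum_le_sum fun g _ => hf.relabel g.1 g.2 R R' i h x

theorem ExPostEfficient.symmetrize {β : ℝ} (hf : ExPostEfficient β f) :
    ExPostEfficient β f.symmetrize := by
  intro R x hx
  rw [SDS.symmetrize_apply, div_le_iff₀ (Nat.cast_pos.2 Fintype.card_pos), mul_comm,
    ← nsmul_eq_mul, ← Finset.card_univ]
  exact Finset.sum_le_card_nsmul _ _ _ fun g _ => hf.relabel g.1 g.2 R x hx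

theorem CondorcetConsistent.symmetrize {α : ℝ} (hf : CondorcetConsistent α f) :
    CondorcetConsistent α f.symmetrize := by
  intro R x hx
  rw [SDS.symmetrize_apply, le_div_iff₀ (Nat.cast_pos.2 Fintype.card_pos), mul_comm,
    ← nsmul_eq_mul, ← Finset.card_univ]
  exact Finset.card_nsmul_le_sum _ _ _ fun g _ => hf.relabel g.1 g.2 R x hx

theorem SDS.symmetrize_anonymous (f : SDS N A) : Anonymous f.symmetrize := by
  intro R π
  refine Subtype.ext (funext fun x => ?_)
  simp only [SDS.symmetrize_apply]
  congr 1
  -- Permuting the voters first only translates the index of the average.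
  rw [← Equiv.sum_comp (Equiv.prodCongr (Equiv.mulRight π) (Equiv.refl _))]
  rfl

theorem SDS.symmetrize_neutral (f : SDS N A) : Neutral f.symmetrize := by
  intro R τ x
  simp only [SDS.symmetrize_apply]
  congr 1
  rw [← Equiv.sum_comp (Equiv.prodCongr (Equiv.refl _) (Equiv.mulRight τ))]
  rfl

end

end SocialChoice

/-! ### Combining the inequalities -/

theorem mainTheorem3 (N A : Type*) [Fintype N] [Fintype A] [Nonempty N] [Nontrivial A]
    (hm : 4 ≤ Fintype.card A) (hn : 5 ≤ Fintype.card N) :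
    (∀ α β : ℝ, β < ((Fintype.card A : ℝ) - 2) / ((Fintype.card A : ℝ) - 1) * α →
      ¬ ∃ f : SocialChoice.SDS N A, SocialChoice.Strategyproof f ∧
        SocialChoice.CondorcetConsistent α f ∧ SocialChoice.ExPostEfficient β f) ∧
    (∀ α β : ℝ, β = ((Fintype.card A : ℝ) - 2) / ((Fintype.card A : ℝ) - 1) * α →
      ∀ f : SocialChoice.SDS N A, SocialChoice.Strategyproof f →
        SocialChoice.Anonymous f → SocialChoice.Neutral f →
        SocialChoice.CondorcetConsistent α f → SocialChoice.ExPostEfficient β f →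
        ∃ l : Set.Icc (0 : ℝ) 1,
          f = SocialChoice.mixture l (SocialChoice.uniformRandomDictatorship N A)
            (SocialChoice.randomizedCopeland N A)) := by
  have hm' : (4 : ℝ) ≤ Fintype.card A := by exact_mod_cast hm
  have hn' : (5 : ℝ) ≤ Fintype.card N := by exact_mod_cast hn
  have hm1 : (0 : ℝ) < Fintype.card A - 1 := by linarith
  refine ⟨?_, ?_⟩
  · rintro α β hαβ ⟨f, hf, hα, hβ⟩
    obtain ⟨c, p, q, hp, hq, hp0, hq0, h⟩ := SocialChoice.exists_apply_eq hf.symmetrize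
      f.symmetrize_anonymous f.symmetrize_neutral (by omega)
    have h₁ := SocialChoice.le_const_of_apply_eq hq0 h
    have h₂ := hβ.symmetrize.const_sub_le hq0 h
    have h₃ := hα.symmetrize.le_const_sub hm hn hq hq0 h
    have hp1 : p 1 ≤ p (Fintype.card A - 1) := hp (by omega)
    have hqg : 0 ≤ q ((Fintype.card N - 1) / 2) := hq0 ▸ hq (Nat.zero_le _)
    rw [div_mul_eq_mul_div, lt_div_iff₀ hm1] at hαβ
    -- Weights m-2 on the Condorcet bound and m-1 on the Pareto bound leave one copy of c, which
    -- `h₁` bounds below so that q(n) cancels.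
    have h₄ := mul_le_mul_of_nonneg_left h₃ (by linarith : (0 : ℝ) ≤ Fintype.card A - 2)
    have h₅ := mul_le_mul_of_nonneg_right h₂ hm1.le
    have h₆ := mul_le_mul_of_nonneg_left hp1 (Nat.cast_nonneg (α := ℝ) (Fintype.card N))
    have h₇ := mul_nonneg (by linarith : (0 : ℝ) ≤ Fintype.card A - 2) hqg
    linarith
  · intro α β hαβ f hf ha hne hα hβ
    obtain ⟨c, p, q, hp, hq, hp0, hq0, h⟩ := SocialChoice.exists_apply_eq hf ha hne (by omega)
    have h₁ := SocialChoice.le_const_of_apply_eq hq0 h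
    have h₂ := hβ.const_sub_le hq0 h
    have h₃ := hα.le_const_sub hm hn hq hq0 h
    have hp1 : p 1 ≤ p (Fintype.card A - 1) := hp (by omega)
    have hqg : 0 ≤ q ((Fintype.card N - 1) / 2) := hq0 ▸ hq (Nat.zero_le _)
    rw [div_mul_eq_mul_div, eq_div_iff hm1.ne'] at hαβ
    have h₄ := mul_le_mul_of_nonneg_left h₃ (by linarith : (0 : ℝ) ≤ Fintype.card A - 2)
    have h₅ := mul_le_mul_of_nonneg_right h₂ hm1.le
    have h₆ := mul_le_mul_of_nonneg_left hp1 (Nat.cast_nonneg (α := ℝ) (Fintype.card N))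
    have h₇ := mul_nonneg (by linarith : (0 : ℝ) ≤ Fintype.card A - 2) hqg
    -- The same chain now starts and ends at 0, so each of its nonnegative slacks vanishes.
    refine SocialChoice.exists_eq_mixture hp hq hp0 hq0 h
      (fun j hj => hf.add_eq_of_apply_eq hp0 hq0 h hj) ?_ ?_ ?_
    · exact mul_left_cancel₀ (by linarith : (Fintype.card N : ℝ) ≠ 0) (by linarith)
    · exact mul_left_cancel₀ (by linarith : (Fintype.card A : ℝ) - 2 ≠ 0) (by linarith)
    · linarith
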